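/- Consider a finite Markov decision process with state space $\mathcal S$, action space $\mathcal A$, transition kernel $P(s'|s,a)$, rewards $r(s,a,s')$ and discount factor $\gamma$, a target policy $\pi$, a behavior policy $\mu$ and features $\phi(s)\in\mathbb R^d$, which form the rows of $\Phi$. For a policy $\nu$ let $[P_\nu]_{ss'}=\sum_a\nu(a|s)P(s'|s,a)$, let $r_\pi(s)=\sum_{a}\pi(a|s)\sum_{s'}P(s'|s,a)\,r(s,a,s')$, and for a probability vector $d_\mu$ on $\mathcal S$ put $D_\mu=\operatorname{diag}(d_\mu)$, $$A_\nu=\Phi^\top D_\mu(I-\gamma P_\nu)\Phi,\quad b=\Phi^\top D_\mu r_\pi,\quad H=\tfrac12(A_\mu+A_\mu^\top),\quad \mathcal G=\begin{pmatrix}0&A_\pi^\top\\-A_\pi&-H\end{pmatrix},\quad h=\begin{pmatrix}0\\b\end{pmatrix}.$$ Assume that: $0<\gamma<1$; $P_\mu$ is irreducible; $d_\mu^\top P_\mu=d_\mu^\top$ and $d_\mu(s)>0$ for all $s$; $\Phi$ has full column rank; and $A_\pi$ is nonsingular. (Features and rewards are bounded automatically.) Let the step sizes $\alpha_t\ge0$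 satisfy $\sum_t\alpha_t=\infty$ and $\sum_t\alpha_t^2<\infty$. Let $z_t=(\theta_t,y_t)\in\mathbb R^{2d}$ be a stochastic process that satisfies $$z_{t+1}=z_t+\alpha_t(\mathcal Gz_t+h+\xi_{t+1}),\qquad t\ge0,$$ where, for a filtration $(\mathcal F_t)$ to which $(z_t)$ is adapted, each $\xi_{t+1}$ is integrable, $\mathbb E[\xi_{t+1}\mid\mathcal F_t]=0$ and $\mathbb E[\|\xi_{t+1}\|^2\mid\mathcal F_t]\le c_\xi(1+\|z_t\|^2)$ almost surely, for some constant $c_\xi>0$ independent of $t$. Then, almost surely, $$\theta_t\to A_\pi^{-1}b,\qquad y_t\to0.$$ In particular this holds for the sample-based STHTD recursion driven by observed transitions $(s_t,a_t,s'_t)$ (for example $s'_t=s_{t+1}$), $$\theta_{t+1}=\theta_t+\alpha_t\rho_t(\phi_t-\gamma\phi'_t)\phi_t^\top y_t,$$ $$y_{t+1}=y_t+\alpha_t\Big[\big(\rho_t\delta_t-\phi_t^\top y_t+\tfrac12\gamma\phi_t'^{\top}y_t\big)\phi_t+\tfrac12\gamma(\phi_t^\top y_t)\phi'_t\Big],$$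 with $\phi_t=\phi(s_t)$, $\phi'_t=\phi(s'_t)$, $\rho_t=\pi(a_t|s_t)/\mu(a_t|s_t)$ and $\delta_t=r(s_t,a_t,s'_t)+\gamma\theta_t^\top\phi'_t-\theta_t^\top\phi_t$, whenever the noise $\xi_{t+1}$, defined as the difference between the sampled update direction (the increment divided by $\alpha_t$) and $\mathcal Gz_t+h$, satisfies the conditions above. -/

import Mathlib

open MeasureTheory ProbabilityTheory Filter Topology Matrix

noncomputable section

/-- A discounted Markov decision process with state space `S` and action space `A`:
transition probabilities `P s a s'`, rewards `r s a s'` and a discount factor in `(0, 1]`. -/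
structure FiniteMDP (S A : Type*) [Fintype S] where
  P : S → A → S → ℝ
  P_nonneg : ∀ s a s', 0 ≤ P s a s'
  P_sum : ∀ s a, ∑ s', P s a s' = 1
  r : S → A → S → ℝ
  γ : ℝ
  γ_pos : 0 < γ
  γ_le_one : γ ≤ 1

/-- A stationary randomized policy; `prob s a` is the probability of action `a` in state `s`. -/
structure Policy (S A : Type*) [Fintype A] where
  prob : S → A → ℝ
  prob_nonneg : ∀ s a, 0 ≤ prob s a
  prob_sum : ∀ s, ∑ a, prob s a = 1

/-- The space `ℝ^{2d}` (with its Euclidean norm) of the joint variable `z = (θ, y)`. -/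
abbrev Joint (d : ℕ) : Type := EuclideanSpace ℝ (Fin d ⊕ Fin d)

/-- The joint variable `z = (θ, y)`. -/
def joint {d : ℕ} (θ y : EuclideanSpace ℝ (Fin d)) : Joint d :=
  WithLp.toLp 2 (Sum.elim θ y)

section Matrices

variable {S A : Type*} [Fintype S] [Fintype A] [DecidableEq S] {d : ℕ}

/-- The state transition matrix `[P_ν]_{ss'} = ∑_a ν(a|s) P(s'|s,a)` induced by `ν`. -/
def transitionMatrix (M : FiniteMDP S A) (ν : Policy S A) : Matrix S S ℝ :=
  Matrix.of fun s s' => ∑ a, ν.prob s a * M.P s a s'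

/-- The expected one-step reward `r_ν(s)` under the policy `ν`. -/
def expectedReward (M : FiniteMDP S A) (ν : Policy S A) : S → ℝ :=
  fun s => ∑ a, ν.prob s a * ∑ s', M.P s a s' * M.r s a s'

/-- The feature matrix `Φ`, whose rows are the feature vectors `φ(s)`. -/
def featureMatrix (φ : S → EuclideanSpace ℝ (Fin d)) : Matrix S (Fin d) ℝ :=
  Matrix.of fun s i => φ s i

/-- `A_ν = Φᵀ D (I - γ P_ν) Φ`, where `D` is the diagonal matrix of the weights `w`. -/
def bellmanMatrix (M : FiniteMDP S A) (ν : Policy S A) (w : S → ℝ)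
    (φ : S → EuclideanSpace ℝ (Fin d)) : Matrix (Fin d) (Fin d) ℝ :=
  (featureMatrix φ)ᵀ * Matrix.diagonal w * (1 - M.γ • transitionMatrix M ν) * featureMatrix φ

/-- `b = Φᵀ D r_π`. -/
def rewardVector (M : FiniteMDP S A) (π : Policy S A) (w : S → ℝ)
    (φ : S → EuclideanSpace ℝ (Fin d)) : Fin d → ℝ :=
  (featureMatrix φ)ᵀ *ᵥ (Matrix.diagonal w *ᵥ expectedReward M π)

/-- The hybrid metric `H = (A_μ + A_μᵀ) / 2`. -/
def hybridMetric (M : FiniteMDP S A) (μ : Policy S A) (w : S → ℝ)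
    (φ : S → EuclideanSpace ℝ (Fin d)) : Matrix (Fin d) (Fin d) ℝ :=
  (1 / 2 : ℝ) • (bellmanMatrix M μ w φ + (bellmanMatrix M μ w φ)ᵀ)

/-- The joint matrix `G = [[0, A_πᵀ], [-A_π, -H]]`. -/
def jointMatrix (M : FiniteMDP S A) (π μ : Policy S A) (w : S → ℝ)
    (φ : S → EuclideanSpace ℝ (Fin d)) : Matrix (Fin d ⊕ Fin d) (Fin d ⊕ Fin d) ℝ :=
  Matrix.fromBlocks 0 (bellmanMatrix M π w φ)ᵀ (-bellmanMatrix M π w φ) (-hybridMetric M μ w φ)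

/-- The mean update direction `G z + h`, with `h = (0, b)`. -/
def meanDirection (M : FiniteMDP S A) (π μ : Policy S A) (w : S → ℝ)
    (φ : S → EuclideanSpace ℝ (Fin d)) (z : Joint d) : Joint d :=
  WithLp.toLp 2 (jointMatrix M π μ w φ *ᵥ z.ofLp + Sum.elim (0 : Fin d → ℝ) (rewardVector M π w φ))

/-- The finite-state conditions. Features and rewards are bounded automatically, since
`S` and `A` are finite. -/
structure BasicAssumption (M : FiniteMDP S A) (π μ : Policy S A) (dμ : S → ℝ)
    (φ : S → EuclideanSpace ℝ (Fin d)) : Prop where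
  γ_lt_one : M.γ < 1
  irreducible : (transitionMatrix M μ).IsIrreducible
  dist_sum : ∑ s, dμ s = 1
  dist_pos : ∀ s, 0 < dμ s
  stationary : dμ ᵥ* transitionMatrix M μ = dμ
  full_column_rank : LinearIndependent ℝ (featureMatrix φ).col
  nonsingular : IsUnit (bellmanMatrix M π dμ φ).det

end Matrices

section Sampling

variable {S A : Type*} [Fintype S] [Fintype A] {d : ℕ}

/-- The importance ratio `ρ = π(a|s) / μ(a|s)`. -/
def importanceRatio (π μ : Policy S A) (s : S) (a : A) : ℝ :=
  π.prob s a / μ.prob s a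

/-- The TD error `δ = r(s,a,s') + γ θᵀφ(s') - θᵀφ(s)`. -/
def tdError (M : FiniteMDP S A) (φ : S → EuclideanSpace ℝ (Fin d))
    (s : S) (a : A) (s' : S) (θ : EuclideanSpace ℝ (Fin d)) : ℝ :=
  M.r s a s' + M.γ * inner ℝ θ (φ s') - inner ℝ θ (φ s)

/-- The sampled direction of `θ`: `ρ (φ(s) - γ φ(s')) φ(s)ᵀ y`. -/
def sampleDirectionPrimal (M : FiniteMDP S A) (π μ : Policy S A)
    (φ : S → EuclideanSpace ℝ (Fin d)) (s : S) (a : A) (s' : S)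
    (y : EuclideanSpace ℝ (Fin d)) : EuclideanSpace ℝ (Fin d) :=
  (importanceRatio π μ s a * inner ℝ (φ s) y) • (φ s - M.γ • φ s')

/-- The sampled direction of `y`:
`(ρ δ - φ(s)ᵀy + (γ/2) φ(s')ᵀy) φ(s) + (γ/2) (φ(s)ᵀy) φ(s')`. -/
def sampleDirectionDual (M : FiniteMDP S A) (π μ : Policy S A)
    (φ : S → EuclideanSpace ℝ (Fin d)) (s : S) (a : A) (s' : S)
    (θ y : EuclideanSpace ℝ (Fin d)) : EuclideanSpace ℝ (Fin d) :=
  (importanceRatio π μ s a * tdError M φ s a s' θ - inner ℝ (φ s) y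
      + 1 / 2 * M.γ * inner ℝ (φ s') y) • φ s
    + (1 / 2 * M.γ * inner ℝ (φ s) y) • φ s'

end Sampling

/-- Robbins–Monro step sizes. -/
structure RobbinsMonro (α : ℕ → ℝ) : Prop where
  nonneg : ∀ t, 0 ≤ α t
  sum_eq_top : Tendsto (fun n => ∑ t ∈ Finset.range n, α t) atTop atTop
  sum_sq : Summable fun t => α t ^ 2

/-- The noise `ξ_{t+1}` is a martingale difference with respect to a filtration to which the
iterates `z_t` are adapted, and its conditional second moment grows at most linearly in `‖z_t‖²`.
The filtration generated by the iterates is one example. The conditional second moment is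
the `[0, ∞]`-valued conditional expectation, so that square integrability is not presupposed. -/
structure NoiseAssumption {Ω : Type*} {mΩ : MeasurableSpace Ω} (Pr : Measure Ω)
    (ℱ : Filtration ℕ mΩ) {d : ℕ} (z ξ : ℕ → Ω → Joint d) : Prop where
  adapted : StronglyAdapted ℱ z
  integrable : ∀ t, Integrable (ξ (t + 1)) Pr
  martingale_difference : ∀ t, Pr[ξ (t + 1) | ℱ t] =ᵐ[Pr] 0
  second_moment : ∃ c : ℝ, 0 < c ∧ ∀ t,
    Pr⁻[fun ω => ‖ξ (t + 1) ω‖ₑ ^ 2 | ℱ t] ≤ᵐ[Pr]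
      fun ω => ENNReal.ofReal (c * (1 + ‖z t ω‖ ^ 2))

end

/-! Centred at the equilibrium z* = (A_π⁻¹ b, 0), the recursion has the linear drift x' = A_πᵀ y, y'
= -A_π x - H y. The plain energy ‖x‖² + ‖y‖² only dissipates through y, because the two skew blocks
cancel. Adding a small cross term 2ε⟪A_π x, y⟫ produces -ε‖A_π x‖² as well, which is coercive in x
since A_π is nonsingular (`exists_saddle_lyapunov`). Dissipation in y needs H positive definite: P_μ
contracts the norm weighted by its stationary law, γ < 1, and Φ is injective
(`exists_coercive_hybridMetric`).

For the resulting quadratic form V, the martingale noise vanishes to first order in α_t and costs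
O(α_t²(1 + V)) to second order. Thus 1 + V is an almost supermartingale, and Robbins–Siegmund
(`ae_tendsto_of_almost_supermartingale`) gives convergence of V and ∑ α_t‖e_t‖² < ∞ almost surely,
where e_t = z_t - z*. Since ∑ α_t = ∞, the limit of V is zero. No moment of z_0 is assumed, so all
integrals carry a bounded, positive, ℱ_0-measurable weight. -/

/-! ### Conditional expectation and almost supermartingales -/

/-- Pull-out property of the `[0, ∞]`-valued conditional expectation, in integrated form. -/
theorem lintegral_mul_condLExp {Ω : Type*} {m mΩ : MeasurableSpace Ω} (hm : m ≤ mΩ)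
    (P : Measure Ω) [IsFiniteMeasure P] {f X : Ω → ENNReal} (hf : Measurable[m] f)
    (hX : AEMeasurable X P) :
    ∫⁻ ω, P⁻[X | m] ω * f ω ∂P = ∫⁻ ω, X ω * f ω ∂P := by
  have hf' : Measurable f := hf.mono hm le_rfl
  -- The two densities define the same measure on `m`, and an `m`-measurable integrand sees nothing
  -- else.
  have htrim : (P.withDensity P⁻[X | m]).trim hm = (P.withDensity X).trim hm := by
    refine @Measure.ext _ m _ _ fun s hs => ?_
    rw [trim_measurableSet_eq hm hs, trim_measurableSet_eq hm hs, withDensity_apply _ (hm s hs),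
      withDensity_apply _ (hm s hs), setLIntegral_condLExp hm P X hs]
  have h1 := lintegral_withDensity_eq_lintegral_mul₀ hX hf'.aemeasurable
  have h2 := lintegral_withDensity_eq_lintegral_mul₀ (μ := P)
    (measurable_condLExp' m P X).aemeasurable hf'.aemeasurable
  simp only [Pi.mul_apply] at h1 h2
  rw [← h1, ← h2, ← lintegral_trim hm hf, ← lintegral_trim hm hf, htrim]

/-- If `∑ a = ∞` while `∑ a v < ∞`, then a convergent `v ≥ 0` has limit zero. -/
theorem limit_eq_zero_of_summable_mul {a v : ℕ → ℝ} {l : ℝ} (ha : ∀ n, 0 ≤ a n)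
    (hv : ∀ n, 0 ≤ v n)
    (hsum : Tendsto (fun n => ∑ t ∈ Finset.range n, a t) atTop atTop)
    (hav : Summable fun n => a n * v n) (hl : Tendsto v atTop (𝓝 l)) : l = 0 := by
  have hl0 : 0 ≤ l := ge_of_tendsto' hl hv
  by_contra hne
  have hpos : 0 < l := lt_of_le_of_ne hl0 (Ne.symm hne)
  -- Eventually v ≥ l/2, so a positive limit would make ∑ a converge.
  have hev : ∀ᶠ n in atTop, ‖a n‖ ≤ 2 / l * (a n * v n) := by
    filter_upwards [hl.eventually_const_lt (half_lt_self hpos)] with n hn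
    rw [Real.norm_of_nonneg (ha n)]
    have h : a n * (l / 2) ≤ a n * v n := mul_le_mul_of_nonneg_left hn.le (ha n)
    calc a n = 2 / l * (a n * (l / 2)) := by field_simp
      _ ≤ _ := by gcongr
  have hs : Summable a := Summable.of_norm_bounded_eventually_nat (hav.mul_left _) hev
  exact not_tendsto_nhds_of_tendsto_atTop hsum _ hs.hasSum.tendsto_sum_nat

/-- **Robbins–Siegmund**: an almost supermartingale `E[X (t+1) | ℱ t] ≤ (1 + β t) X t - Y t`, with
`X, Y ≥ 0` and `∑ β < ∞`, converges almost surely, and `∑ Y < ∞` almost surely. -/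
theorem ae_tendsto_of_almost_supermartingale {Ω : Type*} {mΩ : MeasurableSpace Ω}
    {P : Measure Ω} [IsFiniteMeasure P] {ℱ : Filtration ℕ mΩ} {X Y : ℕ → Ω → ℝ} {β : ℕ → ℝ}
    (hXm : StronglyAdapted ℱ X) (hYm : StronglyAdapted ℱ Y)
    (hXi : ∀ t, Integrable (X t) P) (hYi : ∀ t, Integrable (Y t) P)
    (hX : ∀ t ω, 0 ≤ X t ω) (hY : ∀ t ω, 0 ≤ Y t ω) (hβ : ∀ t, 0 ≤ β t) (hβs : Summable β)
    (h : ∀ t s, MeasurableSet[ℱ t] s →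
      ∫ ω in s, X (t + 1) ω ∂P ≤ (1 + β t) * ∫ ω in s, X t ω ∂P - ∫ ω in s, Y t ω ∂P) :
    ∀ᵐ ω ∂P, (∃ l, Tendsto (fun t => X t ω) atTop (𝓝 l)) ∧ Summable fun t => Y t ω := by
  -- Dividing by p absorbs the growth factors 1 + β; adding back the discounted losses Y makes `W` a
  -- nonnegative supermartingale. Summability of β keeps p bounded, so the normalisation can be
  -- undone at the end.
  set p : ℕ → ℝ := fun t => ∏ k ∈ Finset.range t, (1 + β k) with hp
  have hps : ∀ t, p (t + 1) = p t * (1 + β t) := fun t => Finset.prod_range_succ _ _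
  have hp0 : ∀ t, 0 < p t := fun t => Finset.prod_pos fun k _ => by linarith [hβ k]
  have hpC : ∀ t, p t ≤ Real.exp (∑' k, β k) := fun t => by
    refine le_trans ?_ (Real.exp_le_exp.2 (hβs.sum_le_tsum (Finset.range t) fun k _ => hβ k))
    rw [Real.exp_sum]
    refine Finset.prod_le_prod (fun k _ => by linarith [hβ k]) fun k _ => ?_
    rw [add_comm]
    exact Real.add_one_le_exp (β k)
  have hpmono : Monotone p := monotone_nat_of_le_succ fun t => by
    rw [hps]; nlinarith [hp0 t, hβ t]
  obtain ⟨p', hp'⟩ : ∃ p', Tendsto p atTop (𝓝 p') :=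
    ⟨_, tendsto_atTop_ciSup hpmono ⟨_, by rintro _ ⟨t, rfl⟩; exact hpC t⟩⟩
  set S : ℕ → Ω → ℝ := fun t ω => ∑ k ∈ Finset.range t, (p (k + 1))⁻¹ * Y k ω with hS
  set W : ℕ → Ω → ℝ := fun t ω => (p t)⁻¹ * X t ω + S t ω with hW
  have hS0 : ∀ t ω, 0 ≤ S t ω := fun t ω =>
    Finset.sum_nonneg fun k _ => mul_nonneg (inv_nonneg.2 (hp0 _).le) (hY k ω)
  have hX0 : ∀ t ω, 0 ≤ (p t)⁻¹ * X t ω := fun t ω => mul_nonneg (inv_nonneg.2 (hp0 _).le) (hX t ω)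
  have hSi : ∀ t, Integrable (S t) P := fun t =>
    integrable_finsetSum _ fun k _ => (hYi k).const_mul _
  have hWi : ∀ t, Integrable (W t) P := fun t => ((hXi t).const_mul _).add (hSi t)
  have hWm : StronglyAdapted ℱ W := fun t => by
    refine ((hXm t).const_mul _).add ?_
    refine Finset.stronglyMeasurable_fun_sum _ fun k hk => ?_
    exact ((hYm k).mono (ℱ.mono (Finset.mem_range.1 hk).le)).const_mul _
  have hsuper : Supermartingale W ℱ P := by
    refine supermartingale_of_setIntegral_succ_le hWm hWi fun t s hs => ?_
    have e1 : ∀ t, ∫ ω in s, W t ω ∂P = (p t)⁻¹ * ∫ ω in s, X t ω ∂P + ∫ ω in s, S t ω ∂P :=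
      fun t => by
        rw [← integral_const_mul]
        exact integral_add ((hXi t).const_mul _).integrableOn (hSi t).integrableOn
    have e2 : ∫ ω in s, S (t + 1) ω ∂P =
        ∫ ω in s, S t ω ∂P + (p (t + 1))⁻¹ * ∫ ω in s, Y t ω ∂P := by
      rw [← integral_const_mul, ← integral_add (hSi t).integrableOn
        ((hYi t).const_mul _).integrableOn]
      simp [hS, Finset.sum_range_succ]
    rw [e1, e1, e2]
    have h3 := mul_le_mul_of_nonneg_left (h t s hs) (inv_nonneg.2 (hp0 (t + 1)).le)
    have h4 : (p (t + 1))⁻¹ * ((1 + β t) * ∫ ω in s, X t ω ∂P - ∫ ω in s, Y t ω ∂P) =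
        (p t)⁻¹ * ∫ ω in s, X t ω ∂P - (p (t + 1))⁻¹ * ∫ ω in s, Y t ω ∂P := by
      have : (1 + β t) ≠ 0 := by linarith [hβ t]
      have := (hp0 t).ne'
      rw [hps]; field_simp
    linarith
  -- As W ≥ 0, its L¹ norm is its integral, which decreases in t; this is the bound that
  -- submartingale convergence needs for -W.
  have hbdd : ∀ t, eLpNorm ((-W) t) 1 P ≤ (Real.toNNReal (∫ ω, W 0 ω ∂P) : NNReal) := fun t => by
    have hle : ∫ ω, W t ω ∂P ≤ ∫ ω, W 0 ω ∂P := by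
      simpa using hsuper.setIntegral_le (Nat.zero_le t) (MeasurableSet.univ)
    rw [Pi.neg_apply, eLpNorm_neg, eLpNorm_one_eq_lintegral_enorm,
      ← ofReal_integral_norm_eq_lintegral_enorm (hWi t)]
    refine ENNReal.ofReal_le_ofReal ?_
    refine le_trans (le_of_eq (integral_congr_ae (ae_of_all _ fun ω => ?_))) hle
    exact Real.norm_of_nonneg (add_nonneg (hX0 t ω) (hS0 t ω))
  filter_upwards [hsuper.neg.exists_ae_tendsto_of_bdd hbdd] with ω hω
  obtain ⟨c, hc⟩ := hω
  have hWc : Tendsto (fun t => W t ω) atTop (𝓝 (-c)) := by simpa using hc.neg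
  obtain ⟨C, hC⟩ := hWc.bddAbove_range
  have hSC : ∀ t, S t ω ≤ C := fun t =>
    (le_add_of_nonneg_left (hX0 t ω)).trans (hC ⟨t, rfl⟩)
  have hsummable : Summable fun k => (p (k + 1))⁻¹ * Y k ω :=
    summable_of_sum_range_le (fun k => mul_nonneg (inv_nonneg.2 (hp0 _).le) (hY k ω)) hSC
  refine ⟨⟨p' * (-c - ∑' k, (p (k + 1))⁻¹ * Y k ω), ?_⟩, ?_⟩
  · refine (hp'.mul (hWc.sub hsummable.hasSum.tendsto_sum_nat)).congr fun t => ?_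
    have := (hp0 t).ne'
    simp only [hW, hS, add_sub_cancel_right]
    field_simp
  · refine Summable.of_nonneg_of_le (fun k => hY k ω) (fun k => ?_)
      (hsummable.mul_left (Real.exp (∑' k, β k)))
    rw [← mul_assoc]
    refine le_mul_of_one_le_left (hY k ω) ?_
    rw [← div_eq_mul_inv, one_le_div (hp0 _)]
    exact hpC _

/-! ### Weighted first and second moments of the noise -/

/-- Working in [0, ∞] allows the conditional bound to be integrated before ‖ξ‖² is known to be
integrable; the weighted integrability is then a consequence, in `integrable_mul_norm_sq`. -/
theorem setLIntegral_mul_norm_sq_le {Ω E : Type*} {m mΩ : MeasurableSpace Ω}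
    [NormedAddCommGroup E] (hm : m ≤ mΩ) {P : Measure Ω} [IsFiniteMeasure P] {f b : Ω → ℝ}
    {ξ : Ω → E} (hf : StronglyMeasurable[m] f) (hf0 : ∀ ω, 0 ≤ f ω)
    (hξ : AEStronglyMeasurable ξ P)
    (h : P⁻[fun ω => ‖ξ ω‖ₑ ^ 2 | m] ≤ᵐ[P] fun ω => ENNReal.ofReal (b ω))
    {s : Set Ω} (hs : MeasurableSet[m] s) :
    ∫⁻ ω in s, ENNReal.ofReal (f ω * ‖ξ ω‖ ^ 2) ∂P ≤
      ∫⁻ ω in s, ENNReal.ofReal (f ω * b ω) ∂P := by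
  have hfm : Measurable[m] (s.indicator fun ω => ENNReal.ofReal (f ω)) :=
    (ENNReal.measurable_ofReal.comp hf.measurable).indicator hs
  rw [← lintegral_indicator (hm s hs), ← lintegral_indicator (hm s hs)]
  calc ∫⁻ ω, s.indicator (fun ω => ENNReal.ofReal (f ω * ‖ξ ω‖ ^ 2)) ω ∂P
      = ∫⁻ ω, ‖ξ ω‖ₑ ^ 2 * s.indicator (fun ω => ENNReal.ofReal (f ω)) ω ∂P := by
        refine lintegral_congr fun ω => ?_
        by_cases hω : ω ∈ s
        · simp only [Set.indicator_of_mem hω]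
          rw [ENNReal.ofReal_mul (hf0 ω), mul_comm, ENNReal.ofReal_pow (norm_nonneg _),
            ofReal_norm]
        · simp [hω]
    _ = ∫⁻ ω, P⁻[fun ω => ‖ξ ω‖ₑ ^ 2 | m] ω * s.indicator (fun ω => ENNReal.ofReal (f ω)) ω ∂P :=
        (lintegral_mul_condLExp hm P hfm (hξ.enorm.pow_const 2)).symm
    _ ≤ ∫⁻ ω, ENNReal.ofReal (b ω) * s.indicator (fun ω => ENNReal.ofReal (f ω)) ω ∂P := by
        refine lintegral_mono_ae ?_
        filter_upwards [h] with ω hω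
        gcongr
    _ = _ := by
        refine lintegral_congr fun ω => ?_
        by_cases hω : ω ∈ s
        · simp only [Set.indicator_of_mem hω]
          rw [ENNReal.ofReal_mul (hf0 ω), mul_comm]
        · simp [hω]

theorem integrable_mul_norm_sq {Ω E : Type*} {m mΩ : MeasurableSpace Ω}
    [NormedAddCommGroup E] (hm : m ≤ mΩ) {P : Measure Ω} [IsFiniteMeasure P] {f b : Ω → ℝ}
    {ξ : Ω → E} (hf : StronglyMeasurable[m] f) (hf0 : ∀ ω, 0 ≤ f ω)
    (hξ : AEStronglyMeasurable ξ P)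
    (h : P⁻[fun ω => ‖ξ ω‖ₑ ^ 2 | m] ≤ᵐ[P] fun ω => ENNReal.ofReal (b ω))
    (hfb : Integrable (fun ω => f ω * b ω) P) :
    Integrable (fun ω => f ω * ‖ξ ω‖ ^ 2) P := by
  refine ⟨(hf.mono hm).aestronglyMeasurable.mul (hξ.norm.pow 2), ?_⟩
  rw [hasFiniteIntegral_iff_ofReal (ae_of_all _ fun ω => mul_nonneg (hf0 ω) (sq_nonneg _))]
  have := setLIntegral_mul_norm_sq_le hm hf hf0 hξ h MeasurableSet.univ
  simp only [Measure.restrict_univ] at this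
  refine this.trans_lt (lt_of_le_of_lt (lintegral_mono fun ω => ?_) hfb.2)
  rw [← ofReal_norm]
  exact ENNReal.ofReal_le_ofReal (Real.le_norm_self _)

theorem setIntegral_mul_norm_sq_le {Ω E : Type*} {m mΩ : MeasurableSpace Ω}
    [NormedAddCommGroup E] (hm : m ≤ mΩ) {P : Measure Ω} [IsFiniteMeasure P] {f b : Ω → ℝ}
    {ξ : Ω → E} (hf : StronglyMeasurable[m] f) (hf0 : ∀ ω, 0 ≤ f ω) (hb0 : ∀ ω, 0 ≤ b ω)
    (hξ : AEStronglyMeasurable ξ P)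
    (h : P⁻[fun ω => ‖ξ ω‖ₑ ^ 2 | m] ≤ᵐ[P] fun ω => ENNReal.ofReal (b ω))
    (hfb : Integrable (fun ω => f ω * b ω) P) {s : Set Ω} (hs : MeasurableSet[m] s) :
    ∫ ω in s, f ω * ‖ξ ω‖ ^ 2 ∂P ≤ ∫ ω in s, f ω * b ω ∂P := by
  have hi := integrable_mul_norm_sq hm hf hf0 hξ h hfb
  rw [integral_eq_lintegral_of_nonneg_ae (ae_of_all _ fun ω => mul_nonneg (hf0 ω) (sq_nonneg _))
    hi.1.restrict, integral_eq_lintegral_of_nonneg_ae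
    (ae_of_all _ fun ω => mul_nonneg (hf0 ω) (hb0 ω)) hfb.1.restrict]
  refine ENNReal.toReal_mono ?_ (setLIntegral_mul_norm_sq_le hm hf hf0 hξ h hs)
  have := hfb.integrableOn (s := s) |>.2
  rw [hasFiniteIntegral_iff_ofReal (ae_of_all _ fun ω => mul_nonneg (hf0 ω) (hb0 ω))] at this
  exact this.ne

/-- The `m`-measurable factor comes out of the conditional expectation as soon as the inner product
is integrable; `u` itself need not be. -/
theorem setIntegral_inner_eq_zero {Ω E : Type*} {m mΩ : MeasurableSpace Ω}
    [NormedAddCommGroup E] [InnerProductSpace ℝ E] [CompleteSpace E] (hm : m ≤ mΩ)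
    {P : Measure Ω} [IsFiniteMeasure P] {u ξ : Ω → E} (hu : StronglyMeasurable[m] u)
    (hξ : Integrable ξ P) (h0 : P[ξ | m] =ᵐ[P] 0)
    (hi : Integrable (fun ω => inner ℝ (u ω) (ξ ω)) P) {s : Set Ω} (hs : MeasurableSet[m] s) :
    ∫ ω in s, inner ℝ (u ω) (ξ ω) ∂P = 0 := by
  have h := condExp_bilin_of_stronglyMeasurable_left (m := m) (innerSL ℝ : E →L[ℝ] E →L[ℝ] ℝ)
    hu hi hξ
  have h' : P[fun ω => inner ℝ (u ω) (ξ ω) | m] =ᵐ[P] 0 := by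
    refine h.trans ?_
    filter_upwards [h0] with ω hω
    simp [hω]
  rw [← setIntegral_condExp hm hi hs, setIntegral_congr_ae (hm s hs) (h'.mono fun ω hω _ => hω)]
  simp

/-! ### Stochastic Lyapunov argument -/

/-- Almost sure convergence of a linear stochastic recursion with martingale-difference noise,
given a quadratic Lyapunov function `x ↦ ⟪Q x, x⟫` of its drift. -/
theorem ae_tendsto_zero_of_quadratic_lyapunov {Ω E : Type*} {mΩ : MeasurableSpace Ω}
    [NormedAddCommGroup E] [InnerProductSpace ℝ E] [CompleteSpace E]
    {P : Measure Ω} [IsFiniteMeasure P] {ℱ : Filtration ℕ mΩ} {α : ℕ → ℝ} (hα : RobbinsMonro α)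
    (G Q : E →L[ℝ] E) (hQ : ∀ x y, inner ℝ (Q x) y = inner ℝ x (Q y)) {q κ c : ℝ} (hq : 0 < q)
    (hκ : 0 < κ) (hc : 0 ≤ c) (hQq : ∀ x, q * ‖x‖ ^ 2 ≤ inner ℝ (Q x) x)
    (hG : ∀ x, inner ℝ (Q x) (G x) ≤ -κ * ‖x‖ ^ 2)
    {e ξ : ℕ → Ω → E} (he : StronglyAdapted ℱ e)
    (hrec : ∀ t ω, e (t + 1) ω = e t ω + α t • (G (e t ω) + ξ (t + 1) ω))
    (hξ : ∀ t, Integrable (ξ (t + 1)) P) (hξ0 : ∀ t, P[ξ (t + 1) | ℱ t] =ᵐ[P] 0)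
    (hξ2 : ∀ t, P⁻[fun ω => ‖ξ (t + 1) ω‖ₑ ^ 2 | ℱ t] ≤ᵐ[P]
      fun ω => ENNReal.ofReal (c * (1 + ‖e t ω‖ ^ 2))) :
    ∀ᵐ ω ∂P, Tendsto (fun t => e t ω) atTop (𝓝 0) := by
  -- the weight makes the second moments of the iterates finite
  set g : Ω → ℝ := fun ω => (1 + ‖e 0 ω‖ ^ 2)⁻¹ with hgdef
  have hg0 : ∀ ω, 0 < g ω := fun ω => by positivity
  have hg1 : ∀ ω, g ω ≤ 1 := fun ω => inv_le_one_of_one_le₀ (by nlinarith [sq_nonneg ‖e 0 ω‖])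
  have hgm : ∀ t, StronglyMeasurable[ℱ t] g := fun t => by
    have h1 : StronglyMeasurable[ℱ t] (fun ω => 1 + ‖e 0 ω‖ ^ 2) :=
      stronglyMeasurable_const.add (((he 0).mono (ℱ.mono (Nat.zero_le t))).norm.pow 2)
    exact (h1.measurable.inv).stronglyMeasurable
  have hgm' : AEStronglyMeasurable g P := ((hgm 0).mono (ℱ.le 0)).aestronglyMeasurable
  have hem : ∀ t, AEStronglyMeasurable (e t) P := fun t => ((he t).mono (ℱ.le t)).aestronglyMeasurable
  have hgi : Integrable g P := by
    refine (integrable_const (1 : ℝ)).mono' hgm' (ae_of_all _ fun ω => ?_)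
    rw [Real.norm_of_nonneg (hg0 ω).le]; exact hg1 ω
  have hbound : ∀ t, Integrable (fun ω => g ω * ‖e t ω‖ ^ 2) P →
      Integrable (fun ω => g ω * (c * (1 + ‖e t ω‖ ^ 2))) P := fun t ht => by
    refine ((hgi.add ht).const_mul c).congr (ae_of_all _ fun ω => ?_)
    simp only [Pi.add_apply]; ring
  have hnoise : ∀ t, Integrable (fun ω => g ω * ‖e t ω‖ ^ 2) P →
      Integrable (fun ω => g ω * ‖ξ (t + 1) ω‖ ^ 2) P := fun t ht =>
    integrable_mul_norm_sq (ℱ.le t) (hgm t) (fun ω => (hg0 ω).le) (hξ t).1 (hξ2 t) (hbound t ht)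
  -- At t = 0 the integrand is at most 1 by the choice of `g`; afterwards the growth bound on the
  -- noise propagates finiteness.
  have hei : ∀ t, Integrable (fun ω => g ω * ‖e t ω‖ ^ 2) P := by
    intro t
    induction t with
    | zero =>
      refine (integrable_const (1 : ℝ)).mono' (hgm'.mul ((hem 0).norm.pow 2))
        (ae_of_all _ fun ω => ?_)
      rw [Real.norm_of_nonneg (mul_nonneg (hg0 ω).le (sq_nonneg _)), hgdef]
      rw [inv_mul_le_one₀ (by positivity)]
      linarith
    | succ t ih =>
      refine ((ih.const_mul (2 * (1 + α t * ‖G‖) ^ 2)).add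
        ((hnoise t ih).const_mul (2 * α t ^ 2))).mono' (hgm'.mul ((hem (t + 1)).norm.pow 2))
        (ae_of_all _ fun ω => ?_)
      rw [Real.norm_of_nonneg (mul_nonneg (hg0 ω).le (sq_nonneg _)), Pi.add_apply]
      have hn : ‖e (t + 1) ω‖ ≤ (1 + α t * ‖G‖) * ‖e t ω‖ + α t * ‖ξ (t + 1) ω‖ := by
        rw [hrec]
        calc ‖e t ω + α t • (G (e t ω) + ξ (t + 1) ω)‖
            ≤ ‖e t ω‖ + α t * (‖G (e t ω)‖ + ‖ξ (t + 1) ω‖) := by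
              refine (norm_add_le _ _).trans ?_
              rw [norm_smul, Real.norm_of_nonneg (hα.nonneg t)]
              gcongr
              · exact hα.nonneg t
              · exact norm_add_le _ _
          _ ≤ ‖e t ω‖ + α t * (‖G‖ * ‖e t ω‖ + ‖ξ (t + 1) ω‖) := by
              gcongr
              · exact hα.nonneg t
              · exact G.le_opNorm _
          _ = _ := by ring
      have hsq : ‖e (t + 1) ω‖ ^ 2 ≤
          2 * (1 + α t * ‖G‖) ^ 2 * ‖e t ω‖ ^ 2 + 2 * α t ^ 2 * ‖ξ (t + 1) ω‖ ^ 2 := by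
        have := pow_le_pow_left₀ (norm_nonneg _) hn 2
        nlinarith [sq_nonneg ((1 + α t * ‖G‖) * ‖e t ω‖ - α t * ‖ξ (t + 1) ω‖)]
      nlinarith [mul_le_mul_of_nonneg_left hsq (hg0 ω).le]
  have hquad : ∀ x y : E, ‖inner ℝ (Q x) y‖ ≤ ‖Q‖ * (‖x‖ ^ 2 + ‖y‖ ^ 2) := fun x y => by
    refine (norm_inner_le_norm _ _).trans ?_
    have h1 := mul_le_mul_of_nonneg_right (Q.le_opNorm x) (norm_nonneg y)
    have h2 : ‖x‖ * ‖y‖ ≤ ‖x‖ ^ 2 + ‖y‖ ^ 2 := by nlinarith [sq_nonneg (‖x‖ - ‖y‖), sq_nonneg ‖x‖, sq_nonneg ‖y‖]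
    nlinarith [mul_le_mul_of_nonneg_left h2 (norm_nonneg Q)]
  set V : E → ℝ := fun x => inner ℝ (Q x) x with hV
  have hVc : Continuous V := Q.continuous.inner continuous_id
  have hV0 : ∀ x, 0 ≤ V x := fun x => (by positivity : 0 ≤ q * ‖x‖ ^ 2).trans (hQq x)
  have hVm : ∀ t, StronglyMeasurable[ℱ t] fun ω => V (e t ω) := fun t =>
    hVc.comp_stronglyMeasurable (he t)
  have hVi : ∀ t, Integrable (fun ω => g ω * V (e t ω)) P := fun t => by
    refine ((hei t).const_mul (2 * ‖Q‖)).mono'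
      (hgm'.mul ((hVm t).mono (ℱ.le t)).aestronglyMeasurable) (ae_of_all _ fun ω => ?_)
    rw [norm_mul, Real.norm_of_nonneg (hg0 ω).le]
    have := mul_le_mul_of_nonneg_left (hquad (e t ω) (e t ω)) (hg0 ω).le
    simp only [hV]
    nlinarith
  have hcrossi : ∀ t, Integrable (fun ω =>
      inner ℝ (g ω • Q (e t ω + α t • G (e t ω))) (ξ (t + 1) ω)) P := fun t => by
    have hcm : AEStronglyMeasurable (fun ω => e t ω + α t • G (e t ω)) P :=
      (continuous_id.add (G.continuous.const_smul (α t))).comp_aestronglyMeasurable (hem t)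
    refine (((hei t).const_mul (‖Q‖ * (1 + α t * ‖G‖) ^ 2)).add
      ((hnoise t (hei t)).const_mul ‖Q‖)).mono'
      ((hgm'.smul (Q.continuous.comp_aestronglyMeasurable hcm)).inner (hξ t).1)
      (ae_of_all _ fun ω => ?_)
    rw [real_inner_smul_left, norm_mul, Real.norm_of_nonneg (hg0 ω).le, Pi.add_apply]
    have hn : ‖e t ω + α t • G (e t ω)‖ ≤ (1 + α t * ‖G‖) * ‖e t ω‖ := by
      refine (norm_add_le _ _).trans ?_
      rw [norm_smul, Real.norm_of_nonneg (hα.nonneg t)]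
      nlinarith [mul_le_mul_of_nonneg_left (G.le_opNorm (e t ω)) (hα.nonneg t)]
    have hsq := pow_le_pow_left₀ (norm_nonneg _) hn 2
    have h1 := (hquad (e t ω + α t • G (e t ω)) (ξ (t + 1) ω)).trans
      (mul_le_mul_of_nonneg_left (add_le_add_left hsq _) (norm_nonneg Q))
    have h2 := mul_le_mul_of_nonneg_left h1 (hg0 ω).le
    refine h2.trans (le_of_eq ?_)
    ring
  -- The α² terms are ‖Q‖‖G‖²‖e‖² from the drift and ‖Q‖c(1 + ‖e‖²) from the noise; `K` bounds their
  -- sum by K(1 + V), using ‖e‖² ≤ V/q.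
  set K : ℝ := ‖Q‖ * ‖G‖ ^ 2 / q + ‖Q‖ * c * (1 + 1 / q) with hK
  have hK0 : 0 ≤ K := by positivity
  have hstep : ∀ t ω, g ω * V (e (t + 1) ω) ≤
      (g ω * V (e t ω) - 2 * κ * α t * (g ω * ‖e t ω‖ ^ 2)
        + α t ^ 2 * (‖Q‖ * ‖G‖ ^ 2) * (g ω * ‖e t ω‖ ^ 2))
      + 2 * α t * inner ℝ (g ω • Q (e t ω + α t • G (e t ω))) (ξ (t + 1) ω)
      + α t ^ 2 * ‖Q‖ * (g ω * ‖ξ (t + 1) ω‖ ^ 2) := fun t ω => by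
    have hexp : V (e (t + 1) ω) = V (e t ω) + 2 * α t * inner ℝ (Q (e t ω)) (G (e t ω))
        + α t ^ 2 * V (G (e t ω))
        + 2 * α t * inner ℝ (Q (e t ω + α t • G (e t ω))) (ξ (t + 1) ω)
        + α t ^ 2 * V (ξ (t + 1) ω) := by
      have s1 : ∀ x y, inner ℝ (Q x) y = inner ℝ (Q y) x := fun x y => by
        rw [hQ, real_inner_comm]
      simp only [hV, hrec t ω, map_add, map_smul, inner_add_left, inner_add_right,
        real_inner_smul_left, real_inner_smul_right, smul_add]
      rw [s1 (G (e t ω)) (e t ω), s1 (ξ (t + 1) ω) (e t ω), s1 (ξ (t + 1) ω) (G (e t ω))]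
      ring
    have hVle : ∀ x, V x ≤ ‖Q‖ * ‖x‖ ^ 2 := fun x => by
      refine (real_inner_le_norm _ _).trans ?_
      nlinarith [mul_le_mul_of_nonneg_right (Q.le_opNorm x) (norm_nonneg x)]
    have h1 := mul_le_mul_of_nonneg_left (hG (e t ω)) (hα.nonneg t)
    have h2 : V (G (e t ω)) ≤ ‖Q‖ * ‖G‖ ^ 2 * ‖e t ω‖ ^ 2 := by
      refine (hVle _).trans ?_
      rw [mul_assoc, ← mul_pow]
      gcongr
      exact G.le_opNorm _
    have h3 := hVle (ξ (t + 1) ω)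
    have h4 := mul_le_mul_of_nonneg_left h2 (sq_nonneg (α t))
    have h5 := mul_le_mul_of_nonneg_left h3 (sq_nonneg (α t))
    rw [real_inner_smul_left]
    have h6 : V (e (t + 1) ω) ≤ V (e t ω) - 2 * κ * α t * ‖e t ω‖ ^ 2
        + α t ^ 2 * (‖Q‖ * ‖G‖ ^ 2) * ‖e t ω‖ ^ 2
        + 2 * α t * inner ℝ (Q (e t ω + α t • G (e t ω))) (ξ (t + 1) ω)
        + α t ^ 2 * ‖Q‖ * ‖ξ (t + 1) ω‖ ^ 2 := by
      rw [hexp]; linarith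
    refine (mul_le_mul_of_nonneg_left h6 (hg0 ω).le).trans (le_of_eq ?_)
    ring
  have hmain := ae_tendsto_of_almost_supermartingale (P := P) (ℱ := ℱ)
    -- The summand 1 turns the additive part of the noise variance into part of the factor 1 + β.
    (X := fun t ω => g ω * (1 + V (e t ω))) (Y := fun t ω => α t * (2 * κ * (g ω * ‖e t ω‖ ^ 2)))
    (β := fun t => α t ^ 2 * K)
    (fun t => (hgm t).mul (stronglyMeasurable_const.add (hVm t)))
    (fun t => (((hgm t).mul ((he t).norm.pow 2)).const_mul _).const_mul _)
    (fun t => by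
      refine (hgi.add (hVi t)).congr (ae_of_all _ fun ω => ?_)
      simp only [Pi.add_apply]; ring)
    (fun t => ((hei t).const_mul _).const_mul _)
    (fun t ω => mul_nonneg (hg0 ω).le (by linarith [hV0 (e t ω)]))
    (fun t ω => mul_nonneg (hα.nonneg t) (mul_nonneg (by positivity)
      (mul_nonneg (hg0 ω).le (sq_nonneg _))))
    (fun t => mul_nonneg (sq_nonneg _) hK0) (hα.sum_sq.mul_right K)
    (fun t s hs => by
      have i1 := hgi.integrableOn (s := s)
      have i2 := fun t => (hVi t).integrableOn (s := s)
      have i3 := (hei t).integrableOn (s := s)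
      have i4 := (hcrossi t).integrableOn (s := s)
      have i5 := (hnoise t (hei t)).integrableOn (s := s)
      have z4 : ∫ ω in s, inner ℝ (g ω • Q (e t ω + α t • G (e t ω))) (ξ (t + 1) ω) ∂P = 0 := by
        refine setIntegral_inner_eq_zero (ℱ.le t) ((hgm t).smul ?_) (hξ t) (hξ0 t) (hcrossi t) hs
        exact (Q.continuous.comp
          (continuous_id.add (G.continuous.const_smul (α t)))).comp_stronglyMeasurable (he t)
      have z5 := setIntegral_mul_norm_sq_le (ℱ.le t) (hgm t) (fun ω => (hg0 ω).le)
        (fun ω => by positivity) (hξ t).1 (hξ2 t) (hbound t (hei t)) hs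
      have z5' : ∫ ω in s, g ω * (c * (1 + ‖e t ω‖ ^ 2)) ∂P =
          c * (∫ ω in s, g ω ∂P + ∫ ω in s, g ω * ‖e t ω‖ ^ 2 ∂P) := by
        rw [← integral_add i1 i3, ← integral_const_mul]
        congr 1; ext ω; ring
      have z1 : ∀ t, ∫ ω in s, g ω * (1 + V (e t ω)) ∂P =
          ∫ ω in s, g ω ∂P + ∫ ω in s, g ω * V (e t ω) ∂P := fun t => by
        rw [← integral_add i1 (i2 t)]
        congr 1; ext ω; ring
      have z3 : q * ∫ ω in s, g ω * ‖e t ω‖ ^ 2 ∂P ≤ ∫ ω in s, g ω * V (e t ω) ∂P := by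
        rw [← integral_const_mul]
        refine integral_mono (i3.const_mul q) (i2 t) fun ω => ?_
        have := mul_le_mul_of_nonneg_left (hQq (e t ω)) (hg0 ω).le
        simp only [hV]
        linarith
      have zV0 : 0 ≤ ∫ ω in s, g ω * V (e t ω) ∂P :=
        integral_nonneg fun ω => mul_nonneg (hg0 ω).le (hV0 _)
      have zg0 : 0 ≤ ∫ ω in s, g ω ∂P := integral_nonneg fun ω => (hg0 ω).le
      have j1 := ((i2 t).sub (i3.const_mul (2 * κ * α t))).add
        (i3.const_mul (α t ^ 2 * (‖Q‖ * ‖G‖ ^ 2)))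
      have j2 := i4.const_mul (2 * α t)
      have j3 := i5.const_mul (α t ^ 2 * ‖Q‖)
      have zstep := integral_mono (i2 (t + 1)) ((j1.add j2).add j3) (hstep t)
      rw [integral_add' (j1.add j2) j3, integral_add' j1 j2, integral_add'
        ((i2 t).sub (i3.const_mul (2 * κ * α t))) (i3.const_mul _),
        integral_sub' (i2 t) (i3.const_mul _), integral_const_mul, integral_const_mul,
        integral_const_mul, integral_const_mul, z4] at zstep
      rw [z1, z1, integral_const_mul, integral_const_mul]
      rw [z5'] at z5
      set I := ∫ ω in s, g ω ∂P
      set J := ∫ ω in s, g ω * V (e t ω) ∂P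
      set N := ∫ ω in s, g ω * ‖e t ω‖ ^ 2 ∂P
      have zN : N ≤ J / q := by rw [le_div_iff₀ hq]; linarith
      have a0 : 0 ≤ α t ^ 2 * ‖Q‖ := by positivity
      have a1 : α t ^ 2 * ‖Q‖ * ∫ ω in s, g ω * ‖ξ (t + 1) ω‖ ^ 2 ∂P ≤
          α t ^ 2 * ‖Q‖ * (c * (I + J / q)) :=
        mul_le_mul_of_nonneg_left (z5.trans (by gcongr)) a0
      have a2 : α t ^ 2 * (‖Q‖ * ‖G‖ ^ 2) * N ≤ α t ^ 2 * (‖Q‖ * ‖G‖ ^ 2) * (J / q) := by gcongr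
      have a3 : α t ^ 2 * (‖Q‖ * ‖G‖ ^ 2) * (J / q) + α t ^ 2 * ‖Q‖ * (c * (I + J / q)) ≤
          α t ^ 2 * K * (I + J) := by
        have b1 : 0 ≤ α t ^ 2 * (‖Q‖ * ‖G‖ ^ 2 / q) * I := by positivity
        have b2 : 0 ≤ α t ^ 2 * (‖Q‖ * c * (1 / q)) * I := by positivity
        have b3 : 0 ≤ α t ^ 2 * (‖Q‖ * c) * J := by positivity
        have b4 : α t ^ 2 * K * (I + J) = α t ^ 2 * (‖Q‖ * ‖G‖ ^ 2) * (J / q)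
            + α t ^ 2 * ‖Q‖ * (c * (I + J / q)) + α t ^ 2 * (‖Q‖ * ‖G‖ ^ 2 / q) * I
            + α t ^ 2 * (‖Q‖ * c * (1 / q)) * I + α t ^ 2 * (‖Q‖ * c) * J := by
          rw [hK]; ring
        linarith
      linarith)
  filter_upwards [hmain] with ω hω
  obtain ⟨⟨l, hl⟩, hsum⟩ := hω
  have hVl : Tendsto (fun t => V (e t ω)) atTop (𝓝 (l / g ω - 1)) := by
    refine ((hl.div_const (g ω)).sub_const 1).congr fun t => ?_
    have := (hg0 ω).ne'
    field_simp
    ring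
  -- V ≤ ‖Q‖‖e‖² and g > 0, so the summable losses dominate α V up to a factor depending on ω.
  have hsum' : Summable fun t => α t * V (e t ω) := by
    refine Summable.of_nonneg_of_le (fun t => mul_nonneg (hα.nonneg t) (hV0 _)) (fun t => ?_)
      (hsum.mul_left (‖Q‖ / (2 * κ * g ω)))
    have h1 : V (e t ω) ≤ ‖Q‖ * ‖e t ω‖ ^ 2 := by
      refine (real_inner_le_norm _ _).trans ?_
      nlinarith [mul_le_mul_of_nonneg_right (Q.le_opNorm (e t ω)) (norm_nonneg (e t ω))]
    refine (mul_le_mul_of_nonneg_left h1 (hα.nonneg t)).trans (le_of_eq ?_)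
    have := (hg0 ω).ne'
    field_simp
  have hz := limit_eq_zero_of_summable_mul hα.nonneg (fun t => hV0 _) hα.sum_eq_top hsum' hVl
  rw [hz] at hVl
  rw [tendsto_zero_iff_norm_tendsto_zero]
  have hsq : Tendsto (fun t => ‖e t ω‖ ^ 2) atTop (𝓝 0) := by
    refine squeeze_zero (fun t => sq_nonneg _) (fun t => ?_) (by simpa using hVl.div_const q)
    rw [le_div_iff₀ hq]
    linarith [hQq (e t ω)]
  simpa using hsq.sqrt

/-! ### Lyapunov function of the saddle-point dynamics -/

/-- For `ε` small, `‖x‖² + ‖y‖² + 2 ε ⟪A x, y⟫` is a strict Lyapunov function of the saddle-point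
dynamics `x' = B y`, `y' = -A x - H y`, where `B` is the adjoint of `A`. -/
theorem exists_saddle_lyapunov {F : Type*} [NormedAddCommGroup F] [InnerProductSpace ℝ F]
    (A B H : F →L[ℝ] F) (hAB : ∀ x y, inner ℝ (A x) y = inner ℝ x (B y)) {a η : ℝ} (ha : 0 < a)
    (hη : 0 < η) (hA : ∀ x, a * ‖x‖ ≤ ‖A x‖) (hH : ∀ y, η * ‖y‖ ^ 2 ≤ inner ℝ y (H y)) :
    ∃ ε κ : ℝ, 0 < κ ∧ ∀ x y : F,
      1 / 2 * (‖x‖ ^ 2 + ‖y‖ ^ 2) ≤ inner ℝ (x + ε • B y) x + inner ℝ (ε • A x + y) y ∧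
      inner ℝ (x + ε • B y) (B y) + inner ℝ (ε • A x + y) (-(A x) - H y) ≤
        -κ * (‖x‖ ^ 2 + ‖y‖ ^ 2) := by
  set b : ℝ := ‖B‖ ^ 2 + ‖H‖ ^ 2 / 2 with hb
  have hb0 : 0 ≤ b := by positivity
  -- The first bound keeps the cross term below half of ‖x‖² + ‖y‖²; the second lets the error ε
  -- b‖y‖² consume at most half of the dissipation η‖y‖².
  set ε : ℝ := min (1 / (2 * (‖A‖ + 1))) (η / (2 * (b + 1))) with hε
  have hε0 : 0 < ε := lt_min (by positivity) (by positivity)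
  have hε1 : ε * ‖A‖ ≤ 1 / 2 := by
    have h := min_le_left (1 / (2 * (‖A‖ + 1))) (η / (2 * (b + 1)))
    rw [← hε, le_div_iff₀ (by positivity)] at h
    nlinarith
  have hε2 : ε * b ≤ η / 2 := by
    have h := min_le_right (1 / (2 * (‖A‖ + 1))) (η / (2 * (b + 1)))
    rw [← hε, le_div_iff₀ (by positivity)] at h
    nlinarith
  refine ⟨ε, min (η / 2) (ε * a ^ 2 / 2), lt_min (by positivity) (by positivity), fun x y => ⟨?_, ?_⟩⟩
  · have h1 : |inner ℝ (A x) y| ≤ ‖A‖ * ‖x‖ * ‖y‖ :=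
      (abs_real_inner_le_norm _ _).trans
        (mul_le_mul_of_nonneg_right (A.le_opNorm x) (norm_nonneg y))
    have h2 : inner ℝ (B y) x = inner ℝ (A x) y := by rw [hAB, real_inner_comm]
    simp only [inner_add_left, real_inner_smul_left, h2, real_inner_self_eq_norm_sq]
    have h3 := (abs_le.1 h1).1
    have h4 := mul_le_mul_of_nonneg_left h3 hε0.le
    have h5 : ε * (‖A‖ * ‖x‖ * ‖y‖) ≤ 1 / 2 * (‖x‖ * ‖y‖) := by
      have := mul_le_mul_of_nonneg_right hε1 (mul_nonneg (norm_nonneg x) (norm_nonneg y))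
      linarith
    nlinarith [sq_nonneg (‖x‖ - ‖y‖)]
  · have h2 : inner ℝ x (B y) = inner ℝ y (A x) := by rw [← hAB, real_inner_comm]
    simp only [inner_add_left, real_inner_smul_left, inner_sub_right, inner_neg_right, h2,
      real_inner_self_eq_norm_sq]
    have h3 : |inner ℝ (A x) (H y)| ≤ ‖A x‖ * ‖H y‖ := abs_real_inner_le_norm _ _
    have h4 := (abs_le.1 h3).1
    have hBy : ‖B y‖ ^ 2 ≤ ‖B‖ ^ 2 * ‖y‖ ^ 2 := by
      rw [← mul_pow]; exact pow_le_pow_left₀ (norm_nonneg _) (B.le_opNorm y) 2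
    have hHy : ‖H y‖ ^ 2 ≤ ‖H‖ ^ 2 * ‖y‖ ^ 2 := by
      rw [← mul_pow]; exact pow_le_pow_left₀ (norm_nonneg _) (H.le_opNorm y) 2
    have hAx : a ^ 2 * ‖x‖ ^ 2 ≤ ‖A x‖ ^ 2 := by
      rw [← mul_pow]; exact pow_le_pow_left₀ (by positivity) (hA x) 2
    -- By Young's inequality the mixed term costs half of ‖A x‖² and ‖H y‖²/2, whence the form of
    -- `b`; the other half of ‖A x‖² gives coercivity in x.
    have h5 : ‖B y‖ ^ 2 - ‖A x‖ ^ 2 - inner ℝ (A x) (H y) ≤ b * ‖y‖ ^ 2 - a ^ 2 / 2 * ‖x‖ ^ 2 := by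
      rw [hb]
      nlinarith [sq_nonneg (‖A x‖ - ‖H y‖)]
    have h6 := mul_le_mul_of_nonneg_left h5 hε0.le
    have h7 := mul_le_mul_of_nonneg_right hε2 (sq_nonneg ‖y‖)
    have h8 := mul_le_mul_of_nonneg_right (min_le_left (η / 2) (ε * a ^ 2 / 2)) (sq_nonneg ‖y‖)
    have h9 := mul_le_mul_of_nonneg_right (min_le_right (η / 2) (ε * a ^ 2 / 2)) (sq_nonneg ‖x‖)
    have h10 := hH y
    linarith

/-! ### Block coordinates and matrices as operators -/

theorem inner_joint {d : ℕ} (x y x' y' : EuclideanSpace ℝ (Fin d)) :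
    inner ℝ (joint x y) (joint x' y') = inner ℝ x x' + inner ℝ y y' := by
  simp [joint, PiLp.inner_apply, Fintype.sum_sum_type]

theorem norm_joint_sq {d : ℕ} (x y : EuclideanSpace ℝ (Fin d)) :
    ‖joint x y‖ ^ 2 = ‖x‖ ^ 2 + ‖y‖ ^ 2 := by
  rw [← real_inner_self_eq_norm_sq, inner_joint, real_inner_self_eq_norm_sq,
    real_inner_self_eq_norm_sq]

theorem joint_add {d : ℕ} (x y x' y' : EuclideanSpace ℝ (Fin d)) :
    joint (x + x') (y + y') = joint x y + joint x' y' := by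
  ext i; cases i <;> simp [joint]

theorem joint_smul {d : ℕ} (c : ℝ) (x y : EuclideanSpace ℝ (Fin d)) :
    joint (c • x) (c • y) = c • joint x y := by
  ext i; cases i <;> simp [joint]

theorem joint_sub {d : ℕ} (x y x' y' : EuclideanSpace ℝ (Fin d)) :
    joint (x - x') (y - y') = joint x y - joint x' y' := by
  ext i; cases i <;> simp [joint]

theorem exists_eq_joint {d : ℕ} (z : Joint d) :
    ∃ x y : EuclideanSpace ℝ (Fin d), z = joint x y :=
  ⟨WithLp.toLp 2 fun i => z (Sum.inl i), WithLp.toLp 2 fun i => z (Sum.inr i), by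
    ext i; cases i <;> simp [joint]⟩

theorem toEuclideanCLM_fromBlocks_joint {d : ℕ} (A B C D : Matrix (Fin d) (Fin d) ℝ)
    (x y : EuclideanSpace ℝ (Fin d)) :
    Matrix.toEuclideanCLM (𝕜 := ℝ) (Matrix.fromBlocks A B C D) (joint x y) =
      joint (Matrix.toEuclideanCLM (𝕜 := ℝ) A x + Matrix.toEuclideanCLM (𝕜 := ℝ) B y)
        (Matrix.toEuclideanCLM (𝕜 := ℝ) C x + Matrix.toEuclideanCLM (𝕜 := ℝ) D y) := by
  ext i
  cases i <;> simp [joint, Matrix.fromBlocks_mulVec]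

theorem inner_toEuclideanCLM_left {n : Type*} [Fintype n] [DecidableEq n] (A : Matrix n n ℝ)
    (x y : EuclideanSpace ℝ n) :
    inner ℝ (Matrix.toEuclideanCLM (𝕜 := ℝ) A x) y =
      inner ℝ x (Matrix.toEuclideanCLM (𝕜 := ℝ) Aᵀ y) := by
  rw [real_inner_comm, inner_toEuclideanCLM, inner_toEuclideanCLM, dotProduct_mulVec,
    ← mulVec_transpose, dotProduct_comm]

theorem exists_norm_le_toEuclideanCLM {n : Type*} [Fintype n] [DecidableEq n] {A : Matrix n n ℝ}
    (hA : IsUnit A.det) :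
    ∃ a : ℝ, 0 < a ∧ ∀ x, a * ‖x‖ ≤ ‖Matrix.toEuclideanCLM (𝕜 := ℝ) A x‖ := by
  set N := ‖Matrix.toEuclideanCLM (𝕜 := ℝ) A⁻¹‖ with hN
  have hN0 : 0 ≤ N := norm_nonneg _
  -- The added 1 keeps the constant positive when d = 0, where N = 0.
  refine ⟨(N + 1)⁻¹, by positivity, fun x => ?_⟩
  have h : Matrix.toEuclideanCLM (𝕜 := ℝ) A⁻¹ (Matrix.toEuclideanCLM (𝕜 := ℝ) A x) = x := by
    rw [← mul_apply_eq_comp, ← map_mul, Matrix.nonsing_inv_mul _ hA, map_one]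
    rfl
  have h1 := (Matrix.toEuclideanCLM (𝕜 := ℝ) A⁻¹).le_opNorm (Matrix.toEuclideanCLM (𝕜 := ℝ) A x)
  rw [h, ← hN] at h1
  rw [inv_mul_le_iff₀ (by positivity)]
  linarith [norm_nonneg (Matrix.toEuclideanCLM (𝕜 := ℝ) A x)]

/-! ### Stochastic matrices and coercivity of the hybrid metric -/

theorem transitionMatrix_nonneg {S A : Type*} [Fintype S] [Fintype A] (M : FiniteMDP S A)
    (ν : Policy S A) (s s' : S) :
    0 ≤ transitionMatrix M ν s s' :=
  Finset.sum_nonneg fun a _ => mul_nonneg (ν.prob_nonneg s a) (M.P_nonneg s a s')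

theorem sum_transitionMatrix {S A : Type*} [Fintype S] [Fintype A] (M : FiniteMDP S A)
    (ν : Policy S A) (s : S) :
    ∑ s', transitionMatrix M ν s s' = 1 := by
  simp only [transitionMatrix, Matrix.of_apply]
  rw [Finset.sum_comm]
  simp [← Finset.mul_sum, M.P_sum, ν.prob_sum]

section

variable {S A : Type*} [Fintype S] [Fintype A] [DecidableEq S] {d : ℕ}

/-- A stochastic matrix is a contraction in the norm weighted by a stationary distribution. -/
theorem dotProduct_diagonal_mulVec_le {P : Matrix S S ℝ} {w : S → ℝ} (hP : ∀ s s', 0 ≤ P s s')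
    (hP1 : ∀ s, ∑ s', P s s' = 1) (hw : ∀ s, 0 ≤ w s) (hst : w ᵥ* P = w) (v : S → ℝ) :
    v ⬝ᵥ (Matrix.diagonal w * P) *ᵥ v ≤ ∑ s, w s * v s ^ 2 := by
  have h1 : v ⬝ᵥ (Matrix.diagonal w * P) *ᵥ v = ∑ s, ∑ s', w s * P s s' * (v s * v s') := by
    simp only [dotProduct, mulVec, Matrix.diagonal_mul, Finset.mul_sum]
    refine Finset.sum_congr rfl fun s _ => Finset.sum_congr rfl fun s' _ => ?_
    ring
  have h2 : ∑ s, ∑ s', w s * P s s' * v s ^ 2 = ∑ s, w s * v s ^ 2 := by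
    refine Finset.sum_congr rfl fun s _ => ?_
    rw [← Finset.sum_mul, ← Finset.mul_sum, hP1, mul_one]
  have h3 : ∑ s, ∑ s', w s * P s s' * v s' ^ 2 = ∑ s, w s * v s ^ 2 := by
    rw [Finset.sum_comm]
    refine Finset.sum_congr rfl fun s' _ => ?_
    rw [← Finset.sum_mul]
    congr 1
    exact congrFun hst s'
  -- From 2 v(s) v(s') ≤ v(s)² + v(s')²: the first square is summed by the row sums, the second by
  -- stationarity.
  have h4 : ∑ s, ∑ s', w s * P s s' * (v s * v s') ≤
      ∑ s, ∑ s', (1 / 2 * (w s * P s s' * v s ^ 2) + 1 / 2 * (w s * P s s' * v s' ^ 2)) := by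
    refine Finset.sum_le_sum fun s _ => Finset.sum_le_sum fun s' _ => ?_
    nlinarith [mul_nonneg (mul_nonneg (hw s) (hP s s')) (sq_nonneg (v s - v s'))]
  simp only [Finset.sum_add_distrib, ← Finset.mul_sum] at h4
  rw [h2, h3] at h4
  rw [h1]
  linarith

theorem dotProduct_hybridMetric (M : FiniteMDP S A) (μ : Policy S A) (w : S → ℝ)
    (φ : S → EuclideanSpace ℝ (Fin d)) (y : Fin d → ℝ) :
    y ⬝ᵥ hybridMetric M μ w φ *ᵥ y = y ⬝ᵥ bellmanMatrix M μ w φ *ᵥ y := by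
  have h : y ⬝ᵥ (bellmanMatrix M μ w φ)ᵀ *ᵥ y = y ⬝ᵥ bellmanMatrix M μ w φ *ᵥ y := by
    rw [dotProduct_mulVec, vecMul_transpose, dotProduct_comm]
  rw [hybridMetric, smul_mulVec, add_mulVec, dotProduct_smul, dotProduct_add, h, smul_eq_mul]
  ring

/-- The hybrid metric is positive definite. -/
theorem exists_coercive_hybridMetric {M : FiniteMDP S A} {π μ : Policy S A} {dμ : S → ℝ}
    {φ : S → EuclideanSpace ℝ (Fin d)} (hb : BasicAssumption M π μ dμ φ) :
    ∃ η : ℝ, 0 < η ∧ ∀ y : EuclideanSpace ℝ (Fin d),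
      η * ‖y‖ ^ 2 ≤ inner ℝ y (Matrix.toEuclideanCLM (𝕜 := ℝ) (hybridMetric M μ dμ φ) y) := by
  set L : EuclideanSpace ℝ (Fin d) →ₗ[ℝ] (S → ℝ) :=
    (featureMatrix φ).mulVecLin ∘ₗ (WithLp.linearEquiv 2 ℝ (Fin d → ℝ)).toLinearMap with hL
  have hLa : ∀ y, L y = featureMatrix φ *ᵥ y.ofLp := fun y => rfl
  have hinj : Function.Injective L :=
    (Matrix.mulVec_injective_iff.2 hb.full_column_rank).comp (WithLp.linearEquiv 2 ℝ _).injective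
  obtain ⟨K, hK0, hK⟩ := L.injective_iff_antilipschitz.1 hinj
  have hne : Nonempty S := by
    by_contra h
    rw [not_nonempty_iff] at h
    simpa using hb.dist_sum
  obtain ⟨s₀, hs₀⟩ := Finite.exists_min dμ
  have hK0' : (0 : ℝ) < K := hK0
  have hγ : 0 < 1 - M.γ := sub_pos.2 hb.γ_lt_one
  have hd := hb.dist_pos s₀
  -- 1 - γ comes from the contraction, the least weight compares the weighted norm with the sup norm
  -- of Φy, and K is the antilipschitz constant of y ↦ Φy.
  refine ⟨(1 - M.γ) * dμ s₀ / K ^ 2, by positivity, fun y => ?_⟩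
  rw [inner_toEuclideanCLM, dotProduct_hybridMetric]
  set v := L y with hv
  have h1 : y.ofLp ⬝ᵥ bellmanMatrix M μ dμ φ *ᵥ y.ofLp =
      ∑ s, dμ s * v s ^ 2 - M.γ * (v ⬝ᵥ (Matrix.diagonal dμ * transitionMatrix M μ) *ᵥ v) := by
    have e1 : y.ofLp ⬝ᵥ bellmanMatrix M μ dμ φ *ᵥ y.ofLp =
        v ⬝ᵥ (Matrix.diagonal dμ * (1 - M.γ • transitionMatrix M μ)) *ᵥ v := by
      rw [bellmanMatrix, Matrix.mul_assoc, Matrix.mul_assoc, ← mulVec_mulVec, ← Matrix.mul_assoc,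
        ← mulVec_mulVec, dotProduct_mulVec, vecMul_transpose, ← hLa]
    have e2 : v ⬝ᵥ Matrix.diagonal dμ *ᵥ v = ∑ s, dμ s * v s ^ 2 := by
      simp only [dotProduct, mulVec_diagonal]
      exact Finset.sum_congr rfl fun s _ => by ring
    rw [e1, Matrix.mul_sub, Matrix.mul_one, Matrix.mul_smul, sub_mulVec, dotProduct_sub, e2,
      smul_mulVec, dotProduct_smul, smul_eq_mul]
  have h2 := dotProduct_diagonal_mulVec_le (transitionMatrix_nonneg M μ) (sum_transitionMatrix M μ)
    (fun s => (hb.dist_pos s).le) hb.stationary v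
  have h3 : dμ s₀ * ‖v‖ ^ 2 ≤ ∑ s, dμ s * v s ^ 2 := by
    obtain ⟨s₁, hs₁⟩ := Finite.exists_max fun s => ‖v s‖
    have h4 : ‖v‖ ≤ ‖v s₁‖ := (pi_norm_le_iff_of_nonneg (norm_nonneg _)).2 hs₁
    have h5 : ‖v‖ ^ 2 ≤ v s₁ ^ 2 := by
      rw [← sq_abs (v s₁), ← Real.norm_eq_abs]
      exact pow_le_pow_left₀ (norm_nonneg _) h4 2
    calc dμ s₀ * ‖v‖ ^ 2 ≤ dμ s₁ * v s₁ ^ 2 :=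
          mul_le_mul (hs₀ s₁) h5 (sq_nonneg _) (hb.dist_pos s₁).le
      _ ≤ _ := Finset.single_le_sum (f := fun s => dμ s * v s ^ 2)
          (fun s _ => mul_nonneg (hb.dist_pos s).le (sq_nonneg _)) (Finset.mem_univ s₁)
  have h6 : ‖y‖ ^ 2 ≤ K ^ 2 * ‖v‖ ^ 2 := by
    rw [← mul_pow]
    refine pow_le_pow_left₀ (norm_nonneg _) ?_ 2
    simpa using hK.le_mul_dist y 0
  have h7 : (1 - M.γ) * dμ s₀ / K ^ 2 * ‖y‖ ^ 2 ≤ (1 - M.γ) * (dμ s₀ * ‖v‖ ^ 2) := by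
    rw [div_mul_eq_mul_div, div_le_iff₀ (by positivity)]
    have := mul_le_mul_of_nonneg_left h6 (mul_nonneg hγ.le hd.le)
    linarith
  rw [h1]
  have h8 := mul_le_mul_of_nonneg_left h2 M.γ_pos.le
  have h9 := mul_le_mul_of_nonneg_left h3 hγ.le
  linarith

/-! ### Centring at the equilibrium and conclusion -/

/-- Since A_π A_π⁻¹ b = b, the matrix G sends the equilibrium to (0, -b) = -h. -/
theorem meanDirection_eq {M : FiniteMDP S A} {π μ : Policy S A} {dμ : S → ℝ}
    {φ : S → EuclideanSpace ℝ (Fin d)} (hA : IsUnit (bellmanMatrix M π dμ φ).det) (z : Joint d) :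
    meanDirection M π μ dμ φ z = Matrix.toEuclideanCLM (𝕜 := ℝ) (jointMatrix M π μ dμ φ)
      (z - joint (WithLp.toLp 2 ((bellmanMatrix M π dμ φ)⁻¹ *ᵥ rewardVector M π dμ φ)) 0) := by
  ext i
  rw [map_sub, jointMatrix, toEuclideanCLM_fromBlocks_joint]
  cases i <;> simp [meanDirection, jointMatrix, joint, Matrix.mulVec_mulVec,
    Matrix.mul_nonsing_inv _ hA]

theorem ae_tendsto_of_noiseAssumption (M : FiniteMDP S A) (π μ : Policy S A) (dμ : S → ℝ)
    (φ : S → EuclideanSpace ℝ (Fin d)) (hbasic : BasicAssumption M π μ dμ φ)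
    {Ω : Type*} {mΩ : MeasurableSpace Ω} (Pr : Measure Ω) [IsProbabilityMeasure Pr]
    (ℱ : Filtration ℕ mΩ) (α : ℕ → ℝ) (hα : RobbinsMonro α)
    (θ y : ℕ → Ω → EuclideanSpace ℝ (Fin d)) (ξ : ℕ → Ω → Joint d)
    (hrec : ∀ t ω, joint (θ (t + 1) ω) (y (t + 1) ω) =
      joint (θ t ω) (y t ω) +
        α t • (meanDirection M π μ dμ φ (joint (θ t ω) (y t ω)) + ξ (t + 1) ω))
    (hnoise : NoiseAssumption Pr ℱ (fun t ω => joint (θ t ω) (y t ω)) ξ) :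
    ∀ᵐ ω ∂Pr,
      Tendsto (fun t => θ t ω) atTop
        (𝓝 (WithLp.toLp 2 ((bellmanMatrix M π dμ φ)⁻¹ *ᵥ rewardVector M π dμ φ))) ∧
      Tendsto (fun t => y t ω) atTop (𝓝 0) := by
  set θ' : EuclideanSpace ℝ (Fin d) :=
    WithLp.toLp 2 ((bellmanMatrix M π dμ φ)⁻¹ *ᵥ rewardVector M π dμ φ) with hθ'
  obtain ⟨a, ha, hA⟩ := exists_norm_le_toEuclideanCLM hbasic.nonsingular
  obtain ⟨η, hη, hH⟩ := exists_coercive_hybridMetric hbasic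
  set TA := Matrix.toEuclideanCLM (𝕜 := ℝ) (bellmanMatrix M π dμ φ) with hTA
  set TB := Matrix.toEuclideanCLM (𝕜 := ℝ) (bellmanMatrix M π dμ φ)ᵀ with hTB
  set TH := Matrix.toEuclideanCLM (𝕜 := ℝ) (hybridMetric M μ dμ φ) with hTH
  obtain ⟨ε, κ, hκ, hlyap⟩ := exists_saddle_lyapunov TA TB TH
    (fun x y => inner_toEuclideanCLM_left _ x y) ha hη hA hH
  set G := Matrix.toEuclideanCLM (𝕜 := ℝ) (jointMatrix M π μ dμ φ) with hG
  set Qm : Matrix (Fin d ⊕ Fin d) (Fin d ⊕ Fin d) ℝ := Matrix.fromBlocks 1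
    (ε • (bellmanMatrix M π dμ φ)ᵀ) (ε • bellmanMatrix M π dμ φ) 1 with hQm
  set Q := Matrix.toEuclideanCLM (𝕜 := ℝ) Qm with hQ
  have hGj : ∀ x y, G (joint x y) = joint (TB y) (-(TA x) - TH y) := fun x y => by
    rw [hG, jointMatrix, toEuclideanCLM_fromBlocks_joint]
    simp [map_neg, sub_eq_add_neg, hTA, hTB, hTH]
  have hQj : ∀ x y, Q (joint x y) = joint (x + ε • TB y) (ε • TA x + y) := fun x y => by
    rw [hQ, hQm, toEuclideanCLM_fromBlocks_joint]
    simp [map_smul, hTA, hTB]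
  have hQsymm : ∀ x y, inner ℝ (Q x) y = inner ℝ x (Q y) := fun x y => by
    have : Qmᵀ = Qm := by
      simp [hQm, Matrix.fromBlocks_transpose, Matrix.transpose_smul]
    rw [hQ, inner_toEuclideanCLM_left, this]
  obtain ⟨c, hc, hξ2⟩ := hnoise.second_moment
  set e : ℕ → Ω → Joint d := fun t ω => joint (θ t ω) (y t ω) - joint θ' 0 with he
  have hconv := ae_tendsto_zero_of_quadratic_lyapunov (P := Pr) (ℱ := ℱ) hα G Q hQsymm
    -- With z* = (θ', 0), the new constant comes from 1 + ‖z‖² ≤ 2(1 + ‖z*‖²)(1 + ‖z - z*‖²), which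
    -- moves the noise bound to the centred variable.
    (q := 1 / 2) (κ := κ) (c := c * (2 * (1 + ‖joint θ' 0‖ ^ 2))) one_half_pos hκ (by positivity)
    (fun z => by
      obtain ⟨x, y, rfl⟩ := exists_eq_joint z
      rw [hQj, inner_joint, norm_joint_sq]
      exact (hlyap x y).1)
    (fun z => by
      obtain ⟨x, y, rfl⟩ := exists_eq_joint z
      rw [hQj, hGj, inner_joint, norm_joint_sq]
      exact (hlyap x y).2)
    (e := e) (ξ := ξ) (fun t => (hnoise.adapted t).sub stronglyMeasurable_const)
    (fun t ω => by
      simp only [he]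
      rw [hrec, meanDirection_eq hbasic.nonsingular]
      abel)
    hnoise.integrable hnoise.martingale_difference
    (fun t => (hξ2 t).trans (ae_of_all _ fun ω => ENNReal.ofReal_le_ofReal (by
      rw [mul_assoc]
      refine mul_le_mul_of_nonneg_left ?_ hc.le
      have h1 : ‖joint (θ t ω) (y t ω)‖ ≤ ‖e t ω‖ + ‖joint θ' 0‖ := by
        have := norm_add_le (e t ω) (joint θ' 0)
        simpa [he] using this
      have h2 := pow_le_pow_left₀ (norm_nonneg _) h1 2
      nlinarith [sq_nonneg (‖e t ω‖ - ‖joint θ' 0‖), sq_nonneg (‖e t ω‖ * ‖joint θ' 0‖),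
        sq_nonneg ‖e t ω‖, sq_nonneg ‖joint θ' 0‖])))
  filter_upwards [hconv] with ω hω
  have hej : ∀ t, e t ω = joint (θ t ω - θ') (y t ω) := fun t => by
    simp only [he]
    rw [← joint_sub, sub_zero]
  have hn := tendsto_zero_iff_norm_tendsto_zero.1 hω
  constructor
  · rw [tendsto_iff_norm_sub_tendsto_zero]
    refine squeeze_zero (fun t => norm_nonneg _) (fun t => ?_) hn
    refine (sq_le_sq₀ (norm_nonneg _) (norm_nonneg _)).1 ?_
    rw [hej, norm_joint_sq]
    linarith [sq_nonneg ‖y t ω‖]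
  · rw [tendsto_zero_iff_norm_tendsto_zero]
    refine squeeze_zero (fun t => norm_nonneg _) (fun t => ?_) hn
    refine (sq_le_sq₀ (norm_nonneg _) (norm_nonneg _)).1 ?_
    rw [hej, norm_joint_sq]
    linarith [sq_nonneg ‖θ t ω - θ'‖]

end

/-- Almost-sure convergence of STHTD. The first part concerns every stochastic recursion
`z_{t+1} = z_t + α_t (G z_t + h + ξ_{t+1})`; the second one is the sample-based recursion
driven by observed transitions `(s_t, a_t, s'_t)`, for which `ξ_{t+1}` is the difference
between the sampled direction and the mean direction. -/
theorem theorem2 {S A : Type*} [Fintype S] [Fintype A] [DecidableEq S] {d : ℕ}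
    (M : FiniteMDP S A) (π μ : Policy S A) (dμ : S → ℝ) (φ : S → EuclideanSpace ℝ (Fin d))
    (hbasic : BasicAssumption M π μ dμ φ)
    {Ω : Type*} {mΩ : MeasurableSpace Ω} (Pr : Measure Ω) [IsProbabilityMeasure Pr]
    (ℱ : Filtration ℕ mΩ) (α : ℕ → ℝ) (hα : RobbinsMonro α)
    (θ y : ℕ → Ω → EuclideanSpace ℝ (Fin d)) :
    (∀ ξ : ℕ → Ω → Joint d,
      (∀ t ω, joint (θ (t + 1) ω) (y (t + 1) ω) =
        joint (θ t ω) (y t ω) +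
          α t • (meanDirection M π μ dμ φ (joint (θ t ω) (y t ω)) + ξ (t + 1) ω)) →
      NoiseAssumption Pr ℱ (fun t ω => joint (θ t ω) (y t ω)) ξ →
      ∀ᵐ ω ∂Pr,
        Tendsto (fun t => θ t ω) atTop
          (𝓝 (WithLp.toLp 2 ((bellmanMatrix M π dμ φ)⁻¹ *ᵥ rewardVector M π dμ φ))) ∧
        Tendsto (fun t => y t ω) atTop (𝓝 0)) ∧
    (∀ (s : ℕ → Ω → S) (a : ℕ → Ω → A) (s' : ℕ → Ω → S) (ξ : ℕ → Ω → Joint d),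
      (∀ t ω, θ (t + 1) ω = θ t ω +
        α t • sampleDirectionPrimal M π μ φ (s t ω) (a t ω) (s' t ω) (y t ω)) →
      (∀ t ω, y (t + 1) ω = y t ω +
        α t • sampleDirectionDual M π μ φ (s t ω) (a t ω) (s' t ω) (θ t ω) (y t ω)) →
      (∀ t ω, ξ (t + 1) ω =
        joint (sampleDirectionPrimal M π μ φ (s t ω) (a t ω) (s' t ω) (y t ω))
            (sampleDirectionDual M π μ φ (s t ω) (a t ω) (s' t ω) (θ t ω) (y t ω)) -
          meanDirection M π μ dμ φ (joint (θ t ω) (y t ω))) →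
      NoiseAssumption Pr ℱ (fun t ω => joint (θ t ω) (y t ω)) ξ →
      ∀ᵐ ω ∂Pr,
        Tendsto (fun t => θ t ω) atTop
          (𝓝 (WithLp.toLp 2 ((bellmanMatrix M π dμ φ)⁻¹ *ᵥ rewardVector M π dμ φ))) ∧
        Tendsto (fun t => y t ω) atTop (𝓝 0)) := by
  have key := ae_tendsto_of_noiseAssumption M π μ dμ φ hbasic Pr ℱ α hα θ y
  refine ⟨key, fun s a s' ξ hθ hy hξ hnoise => key ξ (fun t ω => ?_) hnoise⟩
  rw [hξ, hθ, hy, joint_add, joint_smul, add_sub_cancel]
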